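/- Let $\mathbf T=(T_1,T_2)$ be a commuting $2$-variable weighted shift on $\ell^2(\mathbb Z_+^2)$, i.e. $T_1e_{\mathbf k}=\alpha_{\mathbf k}e_{\mathbf k+\varepsilon_1}$ and $T_2e_{\mathbf k}=\beta_{\mathbf k}e_{\mathbf k+\varepsilon_2}$, where $\{e_{\mathbf k}\}$ is the canonical orthonormal basis, $\varepsilon_1=(1,0)$, $\varepsilon_2=(0,1)$, and $\alpha,\beta$ are bounded families of positive numbers with $\beta_{\mathbf k+\varepsilon_1}\alpha_{\mathbf k}=\alpha_{\mathbf k+\varepsilon_2}\beta_{\mathbf k}$ for all $\mathbf k\in\mathbb Z_+^2$. An operator (respectively, a pair of operators) is called subnormal if it is the restriction of a normal operator (respectively, of a commuting pair of normal operators) on a larger Hilbert space to an invariant (respectively, common invariant) subspace. The moments of $\mathbf T$ are $$\gamma_{\mathbf k}=\prod_{i<k_1}\alpha_{(i,0)}^2\prod_{j<k_2}\beta_{(k_1,j)}^2,$$ and a Berger measure of $\mathbf T$ is a Borel probability measure $\mu$ supported in $[0,\|T_1\|^2]\times[0,\|T_2\|^2]$ with $\iint s^{k_1}t^{k_2}\,d\mu(s,t)=\gamma_{\mathbf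 k}$ for all $\mathbf k\in\mathbb Z_+^2$. Similarly, a Berger measure of a unilateral weighted shift $W=\mathrm{shift}(w_0,w_1,\dots)$ is a Borel probability measure $\nu$ supported in $[0,\|W\|^2]$ with $\int s^k\,d\nu(s)=w_0^2\cdots w_{k-1}^2$ for all $k\ge 0$. Let $\mathcal M$ be the closed linear span of $\{e_{\mathbf k}:k_2\ge 1\}$. Assume that the restriction $\mathbf T_{\mathcal M}=(T_1|_{\mathcal M},T_2|_{\mathcal M})$, which is the $2$-variable weighted shift with weights $\alpha_{\mathbf k+\varepsilon_2},\beta_{\mathbf k+\varepsilon_2}$, is subnormal with Berger measure $\mu_{\mathcal M}$, and that the bottom-row shift $W_0=\mathrm{shift}(\alpha_{00},\alpha_{10},\dots)$ is subnormal with Berger measure $\nu$. Write $\|1/t\|=\iint \frac1t\,d\mu_{\mathcal M}(s,t)\in(0,\infty]$, where $\frac1t=\infty$ at $t=0$. When $\|1/t\|<\infty$, let $(\mu_{\mathcal M})_{ext}$ be the probability measure $d(\mu_{\mathcal M})_{ext}(s,t)=\frac{1}{t\,\|1/t\|}\,d\mu_{\mathcal M}(s,t)$, and let $(\mu_{\mathcal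 M})_{ext}^X$ be its marginal in the variable $s$. 1. $\mathbf T$ is subnormal if and only if (i) $\frac1t\in L^1(\mu_{\mathcal M})$, i.e. $\|1/t\|<\infty$; (ii) $\beta_{00}^2\le\|1/t\|^{-1}$; and (iii) $\beta_{00}^2\,\|1/t\|\,(\mu_{\mathcal M})_{ext}^X\le\nu$ as measures. 2. If $\mathbf T$ is subnormal and $\beta_{00}^2\,\|1/t\|=1$, then $(\mu_{\mathcal M})_{ext}^X=\nu$. 3. If $\mathbf T$ is subnormal, then its Berger measure exists, is unique, and equals $$\mu=\beta_{00}^2\,\|1/t\|\,(\mu_{\mathcal M})_{ext}+\bigl(\nu-\beta_{00}^2\,\|1/t\|\,(\mu_{\mathcal M})_{ext}^X\bigr)\times\delta_0,$$ where $\delta_0$ is the Dirac measure at $t=0$. -/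

import Mathlib

open MeasureTheory
open scoped ENNReal

noncomputable section

/-! ### Subnormal operators and subnormal pairs -/

universe u

/-- A bounded operator `T` on `H` is subnormal if it is (up to the isometric embedding `V` of `H`)
the restriction of a normal operator `N` on a Hilbert space `K` to an invariant subspace. -/
def IsSubnormalOp {H : Type u} [NormedAddCommGroup H] [InnerProductSpace ℂ H]
    (T : H →L[ℂ] H) : Prop :=
  ∃ (K : Type u) (_ : NormedAddCommGroup K) (_ : InnerProductSpace ℂ K) (_ : CompleteSpace K)
    (V : H →ₗᵢ[ℂ] K) (N : K →L[ℂ] K),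
    IsStarNormal N ∧ ∀ x, N (V x) = V (T x)

/-- A pair `(T₁, T₂)` of bounded operators on `H` is (jointly) subnormal if it is (up to the
isometric embedding `V` of `H`) the restriction of a commuting pair of normal operators on a
Hilbert space `K` to a common invariant subspace. -/
def IsSubnormalPair {H : Type u} [NormedAddCommGroup H] [InnerProductSpace ℂ H]
    (T₁ T₂ : H →L[ℂ] H) : Prop :=
  ∃ (K : Type u) (_ : NormedAddCommGroup K) (_ : InnerProductSpace ℂ K) (_ : CompleteSpace K)
    (V : H →ₗᵢ[ℂ] K) (N₁ N₂ : K →L[ℂ] K),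
    IsStarNormal N₁ ∧ IsStarNormal N₂ ∧ Commute N₁ N₂ ∧
      (∀ x, N₁ (V x) = V (T₁ x)) ∧ (∀ x, N₂ (V x) = V (T₂ x))

/-! ### Weighted translation operators on `ℓ²(ι)` -/

/-- The complex Hilbert space `ℓ²(ι)`. -/
abbrev EllTwo (ι : Type) : Type := lp (fun _ : ι => ℂ) 2

/-- The canonical orthonormal basis vectors of `ℓ²(ι)`. -/
def stdVec {ι : Type} [DecidableEq ι] (k : ι) : EllTwo ι := lp.single 2 k (1 : ℂ)

/-- The values of the weighted translate: `w k * f k` at the index `σ k`, and `0` off the range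
of `σ`. -/
def weightedTranslateFun {ι : Type} (σ : ι → ι) (w : ι → ℝ) (f : ι → ℂ) : ι → ℂ :=
  Function.extend σ (fun k => (w k : ℂ) * f k) 0

theorem weightedTranslateFun_norm {ι : Type} {σ : ι → ι} (hσ : Function.Injective σ) (w : ι → ℝ)
    (f : ι → ℂ) :
    (fun j => ‖weightedTranslateFun σ w f j‖ ^ (2 : ℝ≥0∞).toReal) =
      Function.extend σ (fun k => ‖(w k : ℂ) * f k‖ ^ (2 : ℝ≥0∞).toReal) 0 := by
  funext j
  by_cases hj : ∃ k, σ k = j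
  · obtain ⟨k, rfl⟩ := hj
    simp [weightedTranslateFun, hσ.extend_apply]
  · rw [weightedTranslateFun, Function.extend_apply' _ _ _ hj, Function.extend_apply' _ _ _ hj]
    simp

theorem weight_mul_le {ι : Type} {w : ι → ℝ} {C : ℝ} (hC : ∀ k, |w k| ≤ C) (f : ι → ℂ) (k : ι) :
    ‖(w k : ℂ) * f k‖ ^ (2 : ℝ≥0∞).toReal ≤
      C ^ (2 : ℝ≥0∞).toReal * ‖f k‖ ^ (2 : ℝ≥0∞).toReal := by
  have h0 : 0 ≤ C := (abs_nonneg _).trans (hC k)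
  rw [← Real.mul_rpow h0 (norm_nonneg _), norm_mul, Complex.norm_real, Real.norm_eq_abs]
  have := hC k
  gcongr

theorem weightedTranslate_summable {ι : Type} {w : ι → ℝ} {C : ℝ} (hC : ∀ k, |w k| ≤ C)
    (f : EllTwo ι) : Summable fun k => ‖(w k : ℂ) * f k‖ ^ (2 : ℝ≥0∞).toReal :=
  Summable.of_nonneg_of_le (fun _ => by positivity) (weight_mul_le hC f)
    (((lp.memℓp f).summable (by simp)).mul_left _)

/-- The bounded operator on `ℓ²(ι)` with `e_k ↦ w k • e_{σ k}`, for an injective `σ` and bounded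
real weights `w`. -/
def weightedTranslate {ι : Type} (σ : ι → ι) (hσ : Function.Injective σ) (w : ι → ℝ)
    (hw : BddAbove (Set.range fun k => |w k|)) : EllTwo ι →L[ℂ] EllTwo ι :=
  LinearMap.mkContinuousOfExistsBound
    { toFun := fun f => ⟨weightedTranslateFun σ w f, by
        obtain ⟨C, hC⟩ := hw
        refine memℓp_gen ?_
        rw [weightedTranslateFun_norm hσ]
        exact (summable_extend_zero hσ).2
          (weightedTranslate_summable (fun k => hC ⟨k, rfl⟩) f)⟩
      map_add' := fun f g => by
        ext j
        change weightedTranslateFun σ w (⇑f + ⇑g) j =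
          weightedTranslateFun σ w f j + weightedTranslateFun σ w g j
        by_cases hj : ∃ k, σ k = j
        · obtain ⟨k, rfl⟩ := hj
          simp [weightedTranslateFun, hσ.extend_apply, mul_add]
        · simp [weightedTranslateFun, Function.extend_apply' _ _ _ hj]
      map_smul' := fun c f => by
        ext j
        by_cases hj : ∃ k, σ k = j
        · obtain ⟨k, rfl⟩ := hj
          simp [weightedTranslateFun, hσ.extend_apply, mul_left_comm]
        · simp [weightedTranslateFun, Function.extend_apply' _ _ _ hj] }
    (by
      obtain ⟨C, hC⟩ := hw
      have hC' : ∀ k, |w k| ≤ C := fun k => hC ⟨k, rfl⟩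
      refine ⟨|C|, fun f => lp.norm_le_of_tsum_le (by simp) (by positivity) ?_⟩
      have hC'' : ∀ k, |w k| ≤ |C| := fun k => (hC' k).trans (le_abs_self C)
      change ∑' j, ‖weightedTranslateFun σ w f j‖ ^ (2 : ℝ≥0∞).toReal ≤ _
      rw [weightedTranslateFun_norm hσ, tsum_extend_zero hσ,
        Real.mul_rpow (by positivity) (by positivity), lp.norm_rpow_eq_tsum (by simp),
        ← tsum_mul_left]
      exact Summable.tsum_le_tsum (weight_mul_le hC'' f) (weightedTranslate_summable hC'' f)
        (((lp.memℓp f).summable (by simp)).mul_left _))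

theorem weightedTranslate_stdVec {ι : Type} [DecidableEq ι] (σ : ι → ι)
    (hσ : Function.Injective σ) (w : ι → ℝ) (hw : BddAbove (Set.range fun k => |w k|)) (k : ι) :
    weightedTranslate σ hσ w hw (stdVec k) = (w k : ℂ) • stdVec (σ k) := by
  ext j
  change weightedTranslateFun σ w (Pi.single k 1) j = (w k : ℂ) * (Pi.single (σ k) 1 : ι → ℂ) j
  by_cases hj : ∃ l, σ l = j
  · obtain ⟨l, rfl⟩ := hj
    by_cases hl : l = k
    · subst hl
      simp [weightedTranslateFun, hσ.extend_apply]
    · simp [weightedTranslateFun, hσ.extend_apply, hl, hσ.eq_iff]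
  · have hjk : j ≠ σ k := fun h => hj ⟨k, h.symm⟩
    simp [weightedTranslateFun, Function.extend_apply' _ _ _ hj, hjk]

theorem bddAbove_abs_of_pos {ι : Type} {w : ι → ℝ} (hpos : ∀ k, 0 < w k)
    (hw : BddAbove (Set.range w)) : BddAbove (Set.range fun k => |w k|) := by
  simpa only [abs_of_pos (hpos _)] using hw

/-! ### One-variable weighted shifts -/

/-- A bounded sequence of positive weights. -/
structure WeightSeq where
  w : ℕ → ℝ
  w_pos : ∀ n, 0 < w n
  w_bdd : BddAbove (Set.range w)

namespace WeightSeq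

/-- The unilateral weighted shift `e_n ↦ w_n e_{n+1}` on `ℓ²(ℕ)`. -/
def shift (a : WeightSeq) : EllTwo ℕ →L[ℂ] EllTwo ℕ :=
  weightedTranslate (fun n => n + 1) (add_left_injective 1) a.w
    (bddAbove_abs_of_pos a.w_pos a.w_bdd)

/-- The moments `γ_k = w_0² ⋯ w_{k-1}²`, with `γ_0 = 1`. -/
def moment (a : WeightSeq) (k : ℕ) : ℝ := ∏ i ∈ Finset.range k, a.w i ^ 2

/-- `ν` is a Berger measure of the shift: a Borel probability measure supported in
`[0, ‖W‖²]` whose moments are the moments of the weight sequence. -/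
def IsBergerMeasure (a : WeightSeq) (ν : Measure ℝ) : Prop :=
  IsProbabilityMeasure ν ∧ ν (Set.Icc 0 (‖a.shift‖ ^ 2))ᶜ = 0 ∧
    ∀ k : ℕ, ∫ s, s ^ k ∂ν = a.moment k

end WeightSeq

/-! ### Two-variable weighted shifts -/

/-- Two bounded positive weight families `α`, `β` on `ℕ × ℕ` satisfying the commutation relation
`β_{k+ε₁} α_k = α_{k+ε₂} β_k`. -/
structure WeightPair where
  α : ℕ × ℕ → ℝ
  β : ℕ × ℕ → ℝ
  α_pos : ∀ k, 0 < α k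
  β_pos : ∀ k, 0 < β k
  α_bdd : BddAbove (Set.range α)
  β_bdd : BddAbove (Set.range β)
  comm : ∀ k : ℕ × ℕ, β (k + (1, 0)) * α k = α (k + (0, 1)) * β k

namespace WeightPair

/-- The operator `T₁ : e_k ↦ α_k e_{k+ε₁}` on `ℓ²(ℕ × ℕ)`. -/
def T₁ (W : WeightPair) : EllTwo (ℕ × ℕ) →L[ℂ] EllTwo (ℕ × ℕ) :=
  weightedTranslate (fun k => k + (1, 0)) (add_left_injective _) W.α
    (bddAbove_abs_of_pos W.α_pos W.α_bdd)

/-- The operator `T₂ : e_k ↦ β_k e_{k+ε₂}` on `ℓ²(ℕ × ℕ)`. -/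
def T₂ (W : WeightPair) : EllTwo (ℕ × ℕ) →L[ℂ] EllTwo (ℕ × ℕ) :=
  weightedTranslate (fun k => k + (0, 1)) (add_left_injective _) W.β
    (bddAbove_abs_of_pos W.β_pos W.β_bdd)

/-- The moments `γ_k = α_{(0,0)}² ⋯ α_{(k₁-1,0)}² β_{(k₁,0)}² ⋯ β_{(k₁,k₂-1)}²`. -/
def moment (W : WeightPair) (k : ℕ × ℕ) : ℝ :=
  (∏ i ∈ Finset.range k.1, W.α (i, 0) ^ 2) * ∏ j ∈ Finset.range k.2, W.β (k.1, j) ^ 2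

/-- `μ` is a Berger measure of the pair: a Borel probability measure supported in
`[0, ‖T₁‖²] × [0, ‖T₂‖²]` whose moments are the moments of the weights. -/
def IsBergerMeasure (W : WeightPair) (μ : Measure (ℝ × ℝ)) : Prop :=
  IsProbabilityMeasure μ ∧
    μ (Set.Icc 0 (‖W.T₁‖ ^ 2) ×ˢ Set.Icc 0 (‖W.T₂‖ ^ 2))ᶜ = 0 ∧
    ∀ k : ℕ × ℕ, ∫ p, p.1 ^ k.1 * p.2 ^ k.2 ∂μ = W.moment k

/-- The subspace `M`, the closed linear span of the `e_k` with `k₂ ≥ 1`. -/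
def subspaceM : Submodule ℂ (EllTwo (ℕ × ℕ)) :=
  (Submodule.span ℂ {x | ∃ k : ℕ × ℕ, 1 ≤ k.2 ∧ stdVec k = x}).topologicalClosure

theorem mapsTo_subspaceM (T : EllTwo (ℕ × ℕ) →L[ℂ] EllTwo (ℕ × ℕ))
    (hT : ∀ k : ℕ × ℕ, 1 ≤ k.2 → T (stdVec k) ∈ subspaceM) :
    ∀ x ∈ subspaceM, T x ∈ subspaceM := by
  have hle : subspaceM ≤ subspaceM.comap T.toLinearMap := by
    refine Submodule.topologicalClosure_minimal _ ?_ ?_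
    · rw [Submodule.span_le]
      rintro _ ⟨k, hk, rfl⟩
      exact hT k hk
    · exact (Submodule.isClosed_topologicalClosure _).preimage T.continuous
  exact fun x hx => hle hx

theorem stdVec_mem_subspaceM {k : ℕ × ℕ} (hk : 1 ≤ k.2) : stdVec k ∈ subspaceM :=
  Submodule.le_topologicalClosure _ (Submodule.subset_span ⟨k, hk, rfl⟩)

theorem T₁_mem (W : WeightPair) : ∀ x ∈ subspaceM, W.T₁ x ∈ subspaceM :=
  mapsTo_subspaceM _ fun k hk => by
    rw [T₁, weightedTranslate_stdVec]
    exact Submodule.smul_mem _ _ (stdVec_mem_subspaceM (by simpa using hk))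

theorem T₂_mem (W : WeightPair) : ∀ x ∈ subspaceM, W.T₂ x ∈ subspaceM :=
  mapsTo_subspaceM _ fun k hk => by
    rw [T₂, weightedTranslate_stdVec]
    exact Submodule.smul_mem _ _ (stdVec_mem_subspaceM (by simp))

/-- The restriction of `T₁` to its invariant subspace `M`. -/
def T₁M (W : WeightPair) : subspaceM →L[ℂ] subspaceM := W.T₁.restrict W.T₁_mem

/-- The restriction of `T₂` to its invariant subspace `M`. -/
def T₂M (W : WeightPair) : subspaceM →L[ℂ] subspaceM := W.T₂.restrict W.T₂_mem

/-- The weights of the restriction `(T₁|M, T₂|M)`, which in the orthonormal basis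
`(e_{k+ε₂})_k` of `M` is the two-variable weighted shift with weights
`(α_{k+ε₂})_k` and `(β_{k+ε₂})_k`. -/
def upper (W : WeightPair) : WeightPair where
  α := fun k => W.α (k + (0, 1))
  β := fun k => W.β (k + (0, 1))
  α_pos := fun _ => W.α_pos _
  β_pos := fun _ => W.β_pos _
  α_bdd := W.α_bdd.mono (Set.range_comp_subset_range (fun k : ℕ × ℕ => k + (0, 1)) W.α)
  β_bdd := W.β_bdd.mono (Set.range_comp_subset_range (fun k : ℕ × ℕ => k + (0, 1)) W.β)
  comm := fun k => by
    have h := W.comm (k + (0, 1))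
    rwa [add_right_comm k (0, 1) (1, 0)] at h

/-- The weights `α_{(0,0)}, α_{(1,0)}, …` of the bottom row. -/
def bottomRow (W : WeightPair) : WeightSeq where
  w := fun n => W.α (n, 0)
  w_pos := fun _ => W.α_pos _
  w_bdd := W.α_bdd.mono (Set.range_comp_subset_range (fun n : ℕ => (n, 0)) W.α)

end WeightPair

/-! ### The extremal measure -/

/-- The norm `‖1/t‖_{L¹(μ)} ∈ [0, ∞]` of the function `(s, t) ↦ 1/t`, for a measure `μ`
concentrated on `t ≥ 0`; here `1/t = ∞` at `t = 0`, and `1/t ∈ L¹(μ)` means that the value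
is finite. -/
def invNorm (μ : Measure (ℝ × ℝ)) : ℝ≥0∞ := ∫⁻ p, (ENNReal.ofReal p.2)⁻¹ ∂μ

/-- The extremal measure `dμ_ext(s,t) = (1 - δ₀(t)) (t ‖1/t‖_{L¹(μ)})⁻¹ dμ(s,t)`. -/
def extremalMeasure (μ : Measure (ℝ × ℝ)) : Measure (ℝ × ℝ) :=
  μ.withDensity fun p => if p.2 = 0 then 0 else (ENNReal.ofReal p.2 * invNorm μ)⁻¹

/-- The marginal measure `μ^X(E) = μ(E × Y)`. -/
def marginalX (μ : Measure (ℝ × ℝ)) : Measure ℝ := μ.map Prod.fst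

end

/-! ### Moments of compactly supported measures -/

/-! The argument passes from operators to measures by Berger's theorem
(`isSubnormalPair_iff_exists_isBergerMeasure`): a pair of shifts is subnormal exactly when its
moments come from a compactly supported measure `μ` on the quadrant. From operators to measures, `μ`
is the joint spectral measure of `N₁*N₁` and `N₂*N₂` at the image of the vacuum vector. Conversely,
`μ` times Haar measure on the two-torus carries multiplication by `√s` and `√t` times the circle
characters, a commuting normal extension.

For measures, everything rests on `t dμ = β₀₀² dμM` (`withDensity_snd`): both sides have the same
moments, and moments determine compactly supported measures. Dividing by `t` shows that `β₀₀² ‖1/t‖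
μ_ext` is the part of `μ` on `t > 0` (`IsBergerMeasure.smul_extremalMeasure`). Hence its mass is at
most 1 and its marginal is at most `μ^X = ν`, which gives the three conditions. The rest of `μ` lies
on `t = 0`, so the marginals fix it as `(ν - …) × δ₀`; this is the formula, with uniqueness.
Conversely, the formula defines a positive measure once the marginal inequality holds, and its
moments are the right ones (`isBergerMeasure_extremal`). -/

theorem continuous_integral_continuousMap {X : Type*} [TopologicalSpace X] [CompactSpace X]
    [MeasurableSpace X] [BorelSpace X] (μ : Measure X) [IsFiniteMeasure μ] :
    Continuous fun f : C(X, ℝ) => ∫ x, f x ∂μ := by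
  have hint (f : C(X, ℝ)) : Integrable f μ :=
    f.continuous.integrable_of_hasCompactSupport (HasCompactSupport.of_compactSpace _)
  let L : C(X, ℝ) →ₗ[ℝ] ℝ :=
    { toFun := fun f => ∫ x, f x ∂μ
      map_add' := fun f g => integral_add (hint f) (hint g)
      map_smul' := fun c f => integral_const_mul c _ }
  refine AddMonoidHomClass.continuous_of_bound L (μ.real Set.univ) fun f => ?_
  rw [mul_comm]
  exact norm_integral_le_of_norm_le_const (.of_forall fun x => f.norm_coe_le_norm x)

theorem integrable_of_continuous_of_isCompact {X : Type*} [TopologicalSpace X]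
    [MeasurableSpace X] [BorelSpace X] {K : Set X} (hK : IsCompact K)
    {μ : Measure X} [IsFiniteMeasure μ] (hμ : μ Kᶜ = 0) {f : X → ℝ}
    (hf : Continuous f) : Integrable f μ := by
  obtain ⟨C, hC⟩ := hK.exists_bound_of_continuousOn hf.continuousOn
  refine .of_bound hf.measurable.aestronglyMeasurable C ?_
  have : ∀ᵐ x ∂μ, x ∈ K := by rwa [ae_iff]
  filter_upwards [this] with x hx using hC x hx

/-- A finite measure on the plane with compact support is determined by its moments. -/
theorem Measure.ext_of_moments {K : Set (ℝ × ℝ)} (hK : IsCompact K) {μ ν : Measure (ℝ × ℝ)}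
    [IsFiniteMeasure μ] [IsFiniteMeasure ν] (hμ : μ Kᶜ = 0) (hν : ν Kᶜ = 0)
    (h : ∀ k l : ℕ, ∫ p, p.1 ^ k * p.2 ^ l ∂μ = ∫ p, p.1 ^ k * p.2 ^ l ∂ν) : μ = ν := by
  have : CompactSpace K := isCompact_iff_compactSpace.1 hK
  have hKm : MeasurableSet K := hK.measurableSet
  have hred : ∀ (ρ : Measure (ℝ × ℝ)), ρ Kᶜ = 0 → ∀ f : ℝ × ℝ → ℝ,
      ∫ x : K, f x ∂(ρ.comap Subtype.val) = ∫ x, f x ∂ρ := fun ρ hρ f => by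
    rw [integral_subtype_comap hKm, Measure.restrict_eq_self_of_ae_mem]
    rwa [ae_iff]
  have hfin (ρ : Measure (ℝ × ℝ)) [IsFiniteMeasure ρ] :
      IsFiniteMeasure (ρ.comap (Subtype.val : K → ℝ × ℝ)) :=
    ⟨by rw [comap_subtype_coe_apply hKm]; exact measure_lt_top _ _⟩
  have := hfin μ
  have := hfin ν
  let x : C(K, ℝ) := ⟨fun p => p.1.1, by fun_prop⟩
  let y : C(K, ℝ) := ⟨fun p => p.1.2, by fun_prop⟩
  -- The functions with equal integrals form a closed subspace. It contains the polynomials, so by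
  -- Stone–Weierstrass it is everything.
  let S : Submodule ℝ C(K, ℝ) :=
    { carrier := {f | ∫ p, f p ∂(μ.comap Subtype.val) = ∫ p, f p ∂(ν.comap Subtype.val)}
      add_mem' := fun {f g} hf hg => by
        have hint (ρ : Measure K) [IsFiniteMeasure ρ] (f : C(K, ℝ)) : Integrable f ρ :=
          f.continuous.integrable_of_hasCompactSupport (HasCompactSupport.of_compactSpace _)
        simp only [Set.mem_ofPred_eq, ContinuousMap.add_apply] at *
        rw [integral_add (hint _ _) (hint _ _), integral_add (hint _ _) (hint _ _), hf, hg]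
      zero_mem' := by simp
      smul_mem' := fun c f hf => by
        simp only [Set.mem_ofPred_eq, ContinuousMap.smul_apply, smul_eq_mul,
          integral_const_mul] at *
        rw [hf] }
  have hSc : IsClosed (S : Set C(K, ℝ)) :=
    isClosed_eq (continuous_integral_continuousMap _) (continuous_integral_continuousMap _)
  have hle : (Algebra.adjoin ℝ {x, y} : Set C(K, ℝ)) ⊆ S := by
    have : Subalgebra.toSubmodule (Algebra.adjoin ℝ {x, y}) ≤ S := by
      rw [Algebra.adjoin_eq_span, Submodule.span_le]
      intro f hf
      obtain ⟨k, l, rfl⟩ := (Submonoid.mem_closure_pair ..).1 hf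
      have := h k l
      rw [← hred μ hμ, ← hred ν hν] at this
      exact this
    exact this
  have htop := ContinuousMap.subalgebra_topologicalClosure_eq_top_of_separatesPoints
    (Algebra.adjoin ℝ {x, y}) (fun p q hpq => by
      by_cases h1 : p.1.1 = q.1.1
      · refine ⟨y, ⟨y, Algebra.subset_adjoin (by simp), rfl⟩, fun h2 => hpq ?_⟩
        exact Subtype.ext (Prod.ext h1 h2)
      · exact ⟨x, ⟨x, Algebra.subset_adjoin (by simp), rfl⟩, h1⟩)
  refine ext_of_forall_integral_eq_of_IsFiniteMeasure fun f => ?_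
  have hmem : (⟨fun p : K => f p, by fun_prop⟩ : C(K, ℝ)) ∈ S := by
    have : (⟨fun p : K => f p, by fun_prop⟩ : C(K, ℝ)) ∈
        (Algebra.adjoin ℝ {x, y}).topologicalClosure := htop ▸ trivial
    exact closure_minimal hle hSc this
  rw [← hred μ hμ, ← hred ν hν]
  exact hmem

/-- A finite measure on the line with compact support is determined by its moments. -/
theorem Measure.ext_of_moments_real {K : Set ℝ} (hK : IsCompact K) {μ ν : Measure ℝ}
    [IsFiniteMeasure μ] [IsFiniteMeasure ν] (hμ : μ Kᶜ = 0) (hν : ν Kᶜ = 0)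
    (h : ∀ k : ℕ, ∫ s, s ^ k ∂μ = ∫ s, s ^ k ∂ν) : μ = ν := by
  -- Reduce to the plane by placing the line at `t = 0`.
  have hm : Measurable fun s : ℝ => (s, (0 : ℝ)) := by fun_prop
  have hc (ρ : Measure ℝ) (hρ : ρ Kᶜ = 0) : (ρ.map fun s => (s, (0 : ℝ))) (K ×ˢ {0})ᶜ = 0 := by
    rw [Measure.map_apply hm (hK.prod isCompact_singleton).measurableSet.compl]
    convert hρ using 2
    ext s
    simp
  have hi (ρ : Measure ℝ) (k l : ℕ) : ∫ p, p.1 ^ k * p.2 ^ l ∂(ρ.map fun s => (s, (0 : ℝ))) =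
      0 ^ l * ∫ s, s ^ k ∂ρ := by
    rw [integral_map hm.aemeasurable (by fun_prop), ← integral_const_mul]
    simp only [mul_comm]
  have key := Measure.ext_of_moments (hK.prod isCompact_singleton) (hc μ hμ) (hc ν hν)
    fun k l => by rw [hi, hi, h]
  have := congrArg (Measure.map Prod.fst) key
  rw [Measure.map_map measurable_fst hm, Measure.map_map measurable_fst hm] at this
  simpa [Function.comp_def] using this

/-- A bounded nonnegative function whose moments are bounded by the powers of `C` is bounded
by `C` almost everywhere. -/
theorem ae_le_of_integral_pow_le {X : Type*} [MeasurableSpace X] {μ : Measure X}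
    [IsFiniteMeasure μ] {f : X → ℝ} (hf : Measurable f) {A C : ℝ} (hC : 0 ≤ C)
    (h0 : ∀ᵐ x ∂μ, 0 ≤ f x) (hA : ∀ᵐ x ∂μ, f x ≤ A) (h : ∀ k : ℕ, ∫ x, f x ^ k ∂μ ≤ C ^ k) :
    ∀ᵐ x ∂μ, f x ≤ C := by
  -- Markov's inequality for `f ^ k` bounds the mass of `{D ≤ f}` by `(C / D) ^ k`, which tends to
  -- 0.
  have key (D : ℝ) (hD : C < D) : μ.real {x | D ≤ f x} = 0 := by
    have hDpos : 0 < D := hC.trans_lt hD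
    have hle (k : ℕ) : μ.real {x | D ≤ f x} ≤ (C / D) ^ k := by
      rw [div_pow, le_div_iff₀ (by positivity), mul_comm]
      have hint : Integrable (fun x => f x ^ k) μ := by
        refine .of_bound (hf.pow_const k).aestronglyMeasurable (A ^ k) ?_
        filter_upwards [h0, hA] with x hx hx'
        rw [Real.norm_of_nonneg (by positivity)]
        gcongr
      refine le_trans ?_ ((mul_meas_ge_le_integral_of_nonneg (ε := D ^ k) ?_ hint).trans (h k))
      · refine mul_le_mul_of_nonneg_left (measureReal_mono fun x hx => ?_) (by positivity)
        exact pow_le_pow_left₀ hDpos.le hx k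
      · filter_upwards [h0] with x hx using pow_nonneg hx k
    refine le_antisymm (ge_of_tendsto' (tendsto_pow_atTop_nhds_zero_of_lt_one (by positivity)
      ((div_lt_one hDpos).2 hD)) hle) measureReal_nonneg
  have hall : ∀ n : ℕ, ∀ᵐ x ∂μ, f x < C + 1 / (n + 1) := fun n => by
    have := key (C + 1 / (n + 1)) (by linarith [Nat.one_div_pos_of_nat (α := ℝ) (n := n)])
    rw [measureReal_eq_zero_iff] at this
    simpa [ae_iff] using this
  filter_upwards [ae_all_iff.2 hall] with x hx
  refine le_of_forall_pos_lt_add fun ε hε => ?_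
  obtain ⟨n, hn⟩ := exists_nat_one_div_lt hε
  linarith [hx n]

/-! ### Norms of weighted translates -/

theorem norm_stdVec {ι : Type} [DecidableEq ι] (k : ι) : ‖stdVec k‖ = 1 := by
  simp [stdVec, lp.norm_single]

theorem abs_weight_le_norm {ι : Type} [DecidableEq ι] (σ : ι → ι) (hσ : Function.Injective σ)
    (w : ι → ℝ) (hw : BddAbove (Set.range fun k => |w k|)) (k : ι) :
    |w k| ≤ ‖weightedTranslate σ hσ w hw‖ := by
  have h := (weightedTranslate σ hσ w hw).le_opNorm (stdVec k)
  rw [weightedTranslate_stdVec, norm_smul, norm_stdVec, norm_stdVec] at h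
  simpa using h

namespace WeightPair

theorem moment_fst_le (W : WeightPair) (k : ℕ) : W.moment (k, 0) ≤ (‖W.T₁‖ ^ 2) ^ k := by
  simp only [moment, Finset.range_zero, Finset.prod_empty, mul_one]
  calc _ ≤ ∏ i ∈ Finset.range k, ‖W.T₁‖ ^ 2 := by
        refine Finset.prod_le_prod (fun _ _ => by positivity) fun i _ => ?_
        rw [← sq_abs]
        gcongr
        exact abs_weight_le_norm _ _ _ _ _
    _ = _ := by simp

theorem moment_snd_le (W : WeightPair) (k : ℕ) : W.moment (0, k) ≤ (‖W.T₂‖ ^ 2) ^ k := by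
  simp only [moment, Finset.range_zero, Finset.prod_empty, one_mul]
  calc _ ≤ ∏ i ∈ Finset.range k, ‖W.T₂‖ ^ 2 := by
        refine Finset.prod_le_prod (fun _ _ => by positivity) fun i _ => ?_
        rw [← sq_abs]
        gcongr
        exact abs_weight_le_norm _ _ _ _ _
    _ = _ := by simp

/-- Support in any bounded rectangle is enough: the growth of the moments along the axes forces the
sharp bounds `‖T₁‖²` and `‖T₂‖²`, and the zeroth moment gives total mass 1. -/
theorem isBergerMeasure_of_moment (W : WeightPair) {μ : Measure (ℝ × ℝ)} [IsFiniteMeasure μ]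
    {A B : ℝ} (hμ : μ (Set.Icc 0 A ×ˢ Set.Icc 0 B)ᶜ = 0)
    (h : ∀ k : ℕ × ℕ, ∫ p, p.1 ^ k.1 * p.2 ^ k.2 ∂μ = W.moment k) : W.IsBergerMeasure μ := by
  have hae : ∀ᵐ p ∂μ, p ∈ Set.Icc 0 A ×ˢ Set.Icc 0 B := by rwa [ae_iff]
  refine ⟨⟨?_⟩, ?_, h⟩
  · have := h 0
    rw [← ENNReal.toReal_eq_one_iff]
    simpa [moment, measureReal_def] using this
  · have h1 := ae_le_of_integral_pow_le (μ := μ) measurable_fst (sq_nonneg ‖W.T₁‖)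
      (hae.mono fun p hp => hp.1.1) (hae.mono fun p hp => hp.1.2) fun k => by
        refine le_trans (le_of_eq ?_) (W.moment_fst_le k)
        rw [← h (k, 0)]
        simp
    have h2 := ae_le_of_integral_pow_le (μ := μ) measurable_snd (sq_nonneg ‖W.T₂‖)
      (hae.mono fun p hp => hp.2.1) (hae.mono fun p hp => hp.2.2) fun k => by
        refine le_trans (le_of_eq ?_) (W.moment_snd_le k)
        rw [← h (0, k)]
        simp
    change ∀ᵐ p ∂μ, p ∈ Set.Icc 0 (‖W.T₁‖ ^ 2) ×ˢ Set.Icc 0 (‖W.T₂‖ ^ 2)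
    filter_upwards [hae, h1, h2] with p hp hp1 hp2 using ⟨⟨hp.1.1, hp1⟩, ⟨hp.2.1, hp2⟩⟩

end WeightPair

/-! ### The spectral measure of a commuting pair of positive operators -/

/-- A positive functional on the continuous functions on a compact space is integration
against a finite measure. -/
theorem exists_measure_of_nonneg {X : Type*} [TopologicalSpace X] [T2Space X] [CompactSpace X]
    [MeasurableSpace X] [BorelSpace X] (Λ : C(X, ℝ) →ₗ[ℝ] ℝ) (hΛ : ∀ f, 0 ≤ f → 0 ≤ Λ f) :
    ∃ μ : Measure X, IsFiniteMeasure μ ∧ ∀ f : C(X, ℝ), ∫ x, f x ∂μ = Λ f := by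
  let L : CompactlySupportedContinuousMap X ℝ →ₗ[ℝ] ℝ :=
    { toFun := fun f => Λ f.toContinuousMap
      map_add' := fun f g => Λ.map_add _ _
      map_smul' := fun c f => Λ.map_smul _ _ }
  let P := PositiveLinearMap.mk₀ L fun f hf => hΛ _ hf
  refine ⟨RealRMK.rieszMeasure P, inferInstance, fun f => ?_⟩
  exact RealRMK.integral_rieszMeasure P (CompactlySupportedContinuousMap.continuousMapEquiv f)

-- A commuting positive pair is the real and imaginary part of the single normal operator `P + iQ`,
-- so the one-variable continuous functional calculus suffices. The measure comes from the Riesz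
-- representation of `f ↦ ⟨x, f(N) x⟩`.
open scoped ComplexOrder in
theorem exists_spectral_measure {H : Type*} [NormedAddCommGroup H] [InnerProductSpace ℂ H]
    [CompleteSpace H] {P Q : H →L[ℂ] H} (hP : 0 ≤ P) (hQ : 0 ≤ Q) (hPQ : Commute P Q) (x : H) :
    ∃ (μ : Measure (ℝ × ℝ)) (A B : ℝ), IsFiniteMeasure μ ∧
      μ (Set.Icc 0 A ×ˢ Set.Icc 0 B)ᶜ = 0 ∧
      ∀ k l : ℕ, ∫ p, p.1 ^ k * p.2 ^ l ∂μ = (inner ℂ x ((P ^ k * Q ^ l) x)).re := by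
  have hPs : IsSelfAdjoint P := hP.isSelfAdjoint
  have hQs : IsSelfAdjoint Q := hQ.isSelfAdjoint
  set N : H →L[ℂ] H := P + Complex.I • Q with hNdef
  have hstar : star N = P - Complex.I • Q := by
    simp [hNdef, star_smul, hPs.star_eq, hQs.star_eq, sub_eq_add_neg]
  have hN : IsStarNormal N := ⟨by
    rw [hstar, hNdef, commute_iff_eq]
    simp only [mul_add, add_mul, sub_mul, mul_sub, smul_mul_assoc, mul_smul_comm, hPQ.eq]
    module⟩
  let Φ := cfcHom (R := ℂ) hN
  let X := spectrum ℂ N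
  have : CompactSpace X := isCompact_iff_compactSpace.1 (spectrum.isCompact N)
  let coe : C(X, ℝ) → C(X, ℂ) := fun f => ⟨fun z => (f z : ℂ), by fun_prop⟩
  have coe_mul (f g) : coe (f * g) = coe f * coe g := by ext; simp [coe]
  have coe_pow (f) (n : ℕ) : coe (f ^ n) = coe f ^ n := by ext; simp [coe]
  have coe_star (f) : star (coe f) = coe f := by ext; simp [coe]
  let u : C(X, ℝ) := ⟨fun z => z.1.re, by fun_prop⟩
  let v : C(X, ℝ) := ⟨fun z => z.1.im, by fun_prop⟩
  let z : C(X, ℂ) := .restrict X (.id ℂ)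
  have hz : Φ z = N := cfcHom_id hN
  have hu : Φ (coe u) = P := by
    have : coe u = (1 / 2 : ℂ) • (z + star z) := by
      ext w
      have := Complex.re_eq_add_conj (w : ℂ)
      simp [coe, u, z, this]
      ring
    rw [this, map_smul, map_add, map_star, hz, hstar, hNdef]
    module
  have hv : Φ (coe v) = Q := by
    have : coe v = (-Complex.I / 2 : ℂ) • (z - star z) := by
      ext w
      have := Complex.im_eq_sub_conj (w : ℂ)
      simp [coe, v, z, this]
      field_simp
      linear_combination ((w : ℂ) - (starRingEnd ℂ) w) * Complex.I_sq
    rw [this, map_smul, map_sub, map_star, hz, hstar, hNdef, add_sub_sub_cancel, ← two_smul ℂ,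
      smul_smul, smul_smul]
    convert one_smul ℂ Q using 2
    linear_combination (-1 : ℂ) * Complex.I_sq
  let Λ : C(X, ℝ) →ₗ[ℝ] ℝ :=
    { toFun := fun f => (inner ℂ x (Φ (coe f) x)).re
      map_add' := fun f g => by
        have : coe (f + g) = coe f + coe g := by ext; simp [coe]
        simp [this]
      map_smul' := fun c f => by
        have : coe (c • f) = (c : ℂ) • coe f := by ext; simp [coe]
        rw [this, map_smul, smul_apply, inner_smul_right, RingHom.id_apply]
        simp }
  obtain ⟨μ, hμf, hμ⟩ := exists_measure_of_nonneg Λ fun f hf => by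
    -- With `g = √f`, the value of the functional is `‖g(N) x‖²`.
    let g : C(X, ℝ) := ⟨fun w => √(f w), by fun_prop⟩
    have hg : f = g * g := by ext w; exact (Real.mul_self_sqrt (hf w)).symm
    change 0 ≤ (inner ℂ x (Φ (coe f) x)).re
    rw [hg, coe_mul, map_mul]
    nth_rewrite 1 [← coe_star]
    rw [map_star, ContinuousLinearMap.star_eq_adjoint, mul_apply_eq_comp,
      ContinuousLinearMap.adjoint_inner_right]
    exact inner_self_nonneg (𝕜 := ℂ)
  -- Spectral mapping: the values of `f` are spectral values of the positive operator `Φ (coe f)`.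
  have hnn (f : C(X, ℝ)) (h : 0 ≤ Φ (coe f)) (w : X) : 0 ≤ f w := by
    have h1 : (f w : ℂ) ∈ spectrum ℂ (Φ (coe f)) := by
      rw [cfcHom_map_spectrum]
      exact ⟨w, rfl⟩
    have := spectrum_nonneg_of_nonneg h h1
    exact Complex.zero_le_real.1 this
  have hm : Measurable fun w : X => (w.1.re, w.1.im) := by fun_prop
  -- The factor `‖1‖` covers the trivial space, where the identity has norm 0.
  refine ⟨μ.map fun w => (w.1.re, w.1.im), ‖N‖ * ‖(1 : H →L[ℂ] H)‖, ‖N‖ * ‖(1 : H →L[ℂ] H)‖, inferInstance, ?_, fun k l => ?_⟩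
  · rw [Measure.map_apply hm (measurableSet_Icc.prod measurableSet_Icc).compl]
    convert measure_empty (μ := μ)
    ext w
    have hw : ‖(w : ℂ)‖ ≤ ‖N‖ * ‖(1 : H →L[ℂ] H)‖ := spectrum.norm_le_norm_mul_of_mem w.2
    simp only [Set.mem_preimage, Set.mem_compl_iff, Set.mem_prod, Set.mem_Icc,
      Set.mem_empty_iff_false, iff_false, not_not]
    exact ⟨⟨hnn u (hu ▸ hP) w, (Complex.re_le_norm _).trans hw⟩,
      ⟨hnn v (hv ▸ hQ) w, (Complex.im_le_norm _).trans hw⟩⟩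
  · rw [integral_map hm.aemeasurable (by fun_prop)]
    rw [← hu, ← hv, ← map_pow, ← map_pow, ← map_mul, ← coe_pow, ← coe_pow, ← coe_mul]
    exact hμ (u ^ k * v ^ l)

/-! ### Existence of Berger measures -/

namespace WeightPair

theorem moment_add_snd (W : WeightPair) (k : ℕ × ℕ) :
    W.moment (k + (0, 1)) = W.moment k * W.β k ^ 2 := by
  simp [moment, Finset.prod_range_succ, mul_assoc]

theorem norm_T₁_pow_T₂_pow (W : WeightPair) (k l : ℕ) :
    ∃ c : ℂ, ‖c‖ ^ 2 = W.moment (k, l) ∧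
      (W.T₂ ^ l) ((W.T₁ ^ k) (stdVec (0, 0))) = c • stdVec (k, l) := by
  induction l with
  | zero =>
    induction k with
    | zero => exact ⟨1, by simp [moment]⟩
    | succ k ih =>
      obtain ⟨c, hc, h⟩ := ih
      refine ⟨c * W.α (k, 0), ?_, ?_⟩
      · simp only [moment, Finset.range_zero, Finset.prod_empty, mul_one] at hc ⊢
        rw [Finset.prod_range_succ, ← hc, norm_mul, mul_pow]
        simp
      · simp only [pow_zero, one_apply_eq_self] at h ⊢
        rw [pow_succ', mul_apply_eq_comp, h, map_smul, T₁, weightedTranslate_stdVec,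
          smul_smul]
        rfl
  | succ l ih =>
    obtain ⟨c, hc, h⟩ := ih
    refine ⟨c * W.β (k, l), ?_, ?_⟩
    · have := W.moment_add_snd (k, l)
      simp only [Prod.mk_add_mk, add_zero] at this
      rw [this, ← hc, norm_mul, mul_pow]
      simp
    · rw [pow_succ', mul_apply_eq_comp, h, map_smul, T₂, weightedTranslate_stdVec,
        smul_smul]
      rfl

end WeightPair

namespace WeightPair

theorem exists_isBergerMeasure_of_isSubnormalPair (W : WeightPair)
    (h : IsSubnormalPair W.T₁ W.T₂) : ∃ μ, W.IsBergerMeasure μ := by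
  obtain ⟨K, _, _, _, V, N₁, N₂, hN₁, hN₂, hN, hV₁, hV₂⟩ := h
  -- Fuglede's theorem: commuting with a normal operator implies commuting with its adjoint.
  have h12 : Commute N₁ (star N₂) := hN₂.commute_star_right hN
  have h21 : Commute (star N₁) N₂ := hN₁.commute_star_left hN
  have hss : Commute (star N₁) (star N₂) := hN₂.commute_star_right h21
  have hPQ : Commute (star N₁ * N₁) (star N₂ * N₂) :=
    (hss.mul_right h21).mul_left (h12.mul_right hN)
  obtain ⟨μ, A, B, hfin, hsupp, hμ⟩ := exists_spectral_measure (star_mul_self_nonneg N₁)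
    (star_mul_self_nonneg N₂) hPQ (V (stdVec (0, 0)))
  refine ⟨μ, W.isBergerMeasure_of_moment hsupp fun ⟨k, l⟩ => ?_⟩
  -- This turns the `(k, l)` moment into `‖N₂ ^ l N₁ ^ k x‖²`, which is computed inside the embedded
  -- `ℓ²`.
  have hpow : (star N₁ * N₁) ^ k * (star N₂ * N₂) ^ l =
      star (N₂ ^ l * N₁ ^ k) * (N₂ ^ l * N₁ ^ k) := by
    rw [hN₁.star_comm_self.mul_pow, hN₂.star_comm_self.mul_pow, star_mul, star_pow, star_pow,
      mul_assoc, mul_assoc, ← mul_assoc (N₁ ^ k), (h12.pow_pow k l).eq, mul_assoc,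
      (hN.pow_pow k l).eq]
  have hV₁' (n : ℕ) (x) : (N₁ ^ n) (V x) = V ((W.T₁ ^ n) x) := by
    induction n with
    | zero => simp
    | succ n ih => rw [pow_succ', mul_apply_eq_comp, ih, hV₁, pow_succ', mul_apply_eq_comp]
  have hV₂' (n : ℕ) (x) : (N₂ ^ n) (V x) = V ((W.T₂ ^ n) x) := by
    induction n with
    | zero => simp
    | succ n ih => rw [pow_succ', mul_apply_eq_comp, ih, hV₂, pow_succ', mul_apply_eq_comp]
  obtain ⟨c, hc, hck⟩ := W.norm_T₁_pow_T₂_pow k l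
  rw [hμ, hpow, mul_apply_eq_comp, ContinuousLinearMap.star_eq_adjoint,
    ContinuousLinearMap.adjoint_inner_right, mul_apply_eq_comp, hV₁', hV₂', hck,
    LinearIsometry.inner_map_map, ← hc]
  have := inner_self_eq_norm_sq (𝕜 := ℂ) (c • stdVec (k, l))
  rw [norm_smul, norm_stdVec, mul_one] at this
  exact this

end WeightPair

/-! ### Multiplication operators on `L²` -/

section MulOp

variable {Ω : Type*} [MeasurableSpace Ω] {m : Measure Ω}

/-- Multiplication by an essentially bounded function, as an operator on `L²`. -/
noncomputable def mulOp {g : Ω → ℂ} (hg : MemLp g ∞ m) : Lp ℂ 2 m →L[ℂ] Lp ℂ 2 m :=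
  (ContinuousLinearMap.mul ℂ ℂ).holderL m ∞ 2 2 (hg.toLp g)

theorem coeFn_mulOp {g : Ω → ℂ} (hg : MemLp g ∞ m) (f : Lp ℂ 2 m) :
    mulOp hg f =ᵐ[m] fun x => g x * f x := by
  have := (ContinuousLinearMap.mul ℂ ℂ).coeFn_holder (r := 2) (hg.toLp g) f
  filter_upwards [this, hg.coeFn_toLp] with x h1 h2
  rw [← h2]
  exact h1

theorem mulOp_toLp {g f : Ω → ℂ} (hg : MemLp g ∞ m) (hf : MemLp f 2 m)
    (hgf : MemLp (fun x => g x * f x) 2 m) : mulOp hg (hf.toLp f) = hgf.toLp _ := by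
  refine Lp.ext ?_
  filter_upwards [coeFn_mulOp hg (hf.toLp f), hf.coeFn_toLp, hgf.coeFn_toLp] with x h1 h2 h3
  rw [h1, h2, h3]

theorem commute_mulOp {g h : Ω → ℂ} (hg : MemLp g ∞ m) (hh : MemLp h ∞ m) :
    Commute (mulOp hg) (mulOp hh) := by
  refine ContinuousLinearMap.ext fun f => Lp.ext ?_
  rw [mul_apply_eq_comp, mul_apply_eq_comp]
  filter_upwards [coeFn_mulOp hg (mulOp hh f), coeFn_mulOp hh (mulOp hg f), coeFn_mulOp hg f,
    coeFn_mulOp hh f] with x h1 h2 h3 h4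
  rw [h1, h2, h3, h4]
  ring

theorem star_mulOp {g : Ω → ℂ} (hg : MemLp g ∞ m) : star (mulOp hg) = mulOp hg.star := by
  rw [ContinuousLinearMap.star_eq_adjoint, eq_comm, ContinuousLinearMap.eq_adjoint_iff]
  intro f h
  rw [L2.inner_def, L2.inner_def]
  refine integral_congr_ae ?_
  filter_upwards [coeFn_mulOp hg h, coeFn_mulOp hg.star f] with x h1 h2
  rw [h1, h2]
  simp
  ring

theorem isStarNormal_mulOp {g : Ω → ℂ} (hg : MemLp g ∞ m) : IsStarNormal (mulOp hg) :=
  ⟨by rw [star_mulOp]; exact commute_mulOp _ _⟩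

end MulOp

/-! ### Subnormality from a Berger measure -/

namespace WeightPair

/-- The defining path goes right, then up. The commutation relation, applied row by row, makes the
product independent of the path. -/
theorem moment_add_fst (W : WeightPair) (k : ℕ × ℕ) :
    W.moment (k + (1, 0)) = W.moment k * W.α k ^ 2 := by
  obtain ⟨k, l⟩ := k
  simp only [Prod.mk_add_mk, add_zero]
  induction l with
  | zero => simp [moment, Finset.prod_range_succ]
  | succ l ih =>
    have h1 := W.moment_add_snd (k + 1, l)
    have h2 := W.moment_add_snd (k, l)
    have h3 := W.comm (k, l)
    simp only [Prod.mk_add_mk, add_zero] at h1 h2 h3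
    rw [h1, h2, ih]
    linear_combination W.moment (k, l) * (W.β (k + 1, l) * W.α (k, l) +
      W.α (k, l + 1) * W.β (k, l)) * h3

theorem moment_pos (W : WeightPair) (k : ℕ × ℕ) : 0 < W.moment k :=
  mul_pos (Finset.prod_pos fun _ _ => pow_pos (W.α_pos _) 2)
    (Finset.prod_pos fun _ _ => pow_pos (W.β_pos _) 2)

theorem _root_.EllTwo.continuousLinearMap_ext {ι : Type} [DecidableEq ι] {K : Type*}
    [NormedAddCommGroup K] [NormedSpace ℂ K] {S T : EllTwo ι →L[ℂ] K}
    (h : ∀ k, S (stdVec k) = T (stdVec k)) : S = T := by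
  refine ContinuousLinearMap.ext fun x => ?_
  have hx := lp.hasSum_single (by simp) x
  refine (hx.mapL S).unique ?_
  convert hx.mapL T using 2 with k
  have : lp.single 2 k (x k) = (x k : ℂ) • stdVec k := by
    rw [stdVec, ← lp.single_smul, smul_eq_mul, mul_one]
  rw [this, map_smul, map_smul, h]

/-- A pair of weighted shifts whose moments are represented by the orthogonal powers
`z ^ k₁ * w ^ k₂` of bounded functions is subnormal. -/
theorem isSubnormalPair_of_orthogonal (W : WeightPair) {Ω : Type} [MeasurableSpace Ω]
    {m : Measure Ω} [IsFiniteMeasure m] {z w : Ω → ℂ} (hz : MemLp z ∞ m) (hw : MemLp w ∞ m)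
    (h : ∀ k l : ℕ × ℕ, ∫ x, starRingEnd ℂ (z x ^ k.1 * w x ^ k.2) * (z x ^ l.1 * w x ^ l.2) ∂m =
      if k = l then (W.moment k : ℂ) else 0) : IsSubnormalPair W.T₁ W.T₂ := by
  have hpow {g : Ω → ℂ} (hg : MemLp g ∞ m) (n : ℕ) : MemLp (fun x => g x ^ n) ∞ m := by
    induction n with
    | zero => simpa using memLp_const (1 : ℂ)
    | succ n ih =>
      simp only [pow_succ]
      exact hg.mul ih
  have hmem (k : ℕ × ℕ) : MemLp (fun x => z x ^ k.1 * w x ^ k.2) 2 m :=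
    ((hpow hw k.2).mul (hpow hz k.1) : MemLp _ ∞ m).mono_exponent le_top
  let e : ℕ × ℕ → Lp ℂ 2 m := fun k => ((√(W.moment k))⁻¹ : ℂ) • (hmem k).toLp _
  have hinner (k l : ℕ × ℕ) : inner ℂ ((hmem k).toLp _) ((hmem l).toLp _) =
      if k = l then (W.moment k : ℂ) else 0 := by
    rw [← h k l, L2.inner_def]
    refine integral_congr_ae ?_
    filter_upwards [(hmem k).coeFn_toLp, (hmem l).coeFn_toLp] with x h1 h2
    rw [h1, h2, RCLike.inner_apply, mul_comm]
  have hsqrt (k) : ((√(W.moment k) : ℝ) : ℂ) ≠ 0 := by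
    exact_mod_cast (Real.sqrt_pos.2 (W.moment_pos k)).ne'
  have he : Orthonormal ℂ e := by
    rw [orthonormal_iff_ite]
    intro k l
    rw [inner_smul_left, inner_smul_right, hinner]
    split_ifs with hkl
    · subst hkl
      have : (W.moment k : ℂ) = √(W.moment k) * √(W.moment k) := by
        exact_mod_cast (Real.mul_self_sqrt (W.moment_pos k).le).symm
      rw [map_inv₀, Complex.conj_ofReal, this]
      field_simp [hsqrt k]
    · simp
  let V := he.orthogonalFamily.linearIsometry
  have hV (k) : V (stdVec k) = e k := by
    simp [V, stdVec]
  -- The normalizing factors of `e k` and `e l` differ by `√γ_l / √γ_k = a`, which is the weight.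
  have hstep {g : Ω → ℂ} (hg : MemLp g ∞ m) (k l : ℕ × ℕ) (a : ℝ) (ha : 0 < a)
      (hl : W.moment l = W.moment k * a ^ 2)
      (hgl : ∀ x, g x * (z x ^ k.1 * w x ^ k.2) = z x ^ l.1 * w x ^ l.2) :
      mulOp hg (e k) = (a : ℂ) • e l := by
    have hs : √(W.moment l) = √(W.moment k) * a := by
      rw [hl, Real.sqrt_mul (W.moment_pos k).le, Real.sqrt_sq ha.le]
    have ha' : (a : ℂ) ≠ 0 := by exact_mod_cast ha.ne'
    rw [map_smul, mulOp_toLp hg (hmem k) (by simpa only [hgl] using hmem l), smul_smul]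
    congr 1
    · rw [hs]
      push_cast
      field_simp
    · simp only [hgl]
  refine ⟨Lp ℂ 2 m, inferInstance, inferInstance, inferInstance, V, mulOp hz, mulOp hw,
    isStarNormal_mulOp hz, isStarNormal_mulOp hw, commute_mulOp hz hw, ?_, ?_⟩
  · refine DFunLike.congr_fun (EllTwo.continuousLinearMap_ext
      (S := (mulOp hz).comp V.toContinuousLinearMap)
      (T := V.toContinuousLinearMap.comp W.T₁) fun k => ?_)
    change mulOp hz (V (stdVec k)) = V (W.T₁ (stdVec k))
    rw [hV, T₁, weightedTranslate_stdVec, V.map_smul, hV]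
    refine hstep hz k _ _ (W.α_pos k) (W.moment_add_fst k) fun x => ?_
    simp only [Prod.fst_add, Prod.snd_add]
    ring
  · refine DFunLike.congr_fun (EllTwo.continuousLinearMap_ext
      (S := (mulOp hw).comp V.toContinuousLinearMap)
      (T := V.toContinuousLinearMap.comp W.T₂) fun k => ?_)
    change mulOp hw (V (stdVec k)) = V (W.T₂ (stdVec k))
    rw [hV, T₂, weightedTranslate_stdVec, V.map_smul, hV]
    refine hstep hw k _ _ (W.β_pos k) (W.moment_add_snd k) fun x => ?_
    simp only [Prod.fst_add, Prod.snd_add]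
    ring

theorem _root_.integral_fourier_haarAddCircle (n : ℤ) :
    ∫ x : UnitAddCircle, fourier n x ∂AddCircle.haarAddCircle = if n = 0 then 1 else 0 := by
  have h := orthonormal_iff_ite.1 (orthonormal_fourier (T := 1)) 0 n
  rw [ContinuousMap.inner_toLp (@AddCircle.haarAddCircle 1 _) (fourier 0) (fourier n)] at h
  simpa [eq_comm] using h

theorem isSubnormalPair_of_isBergerMeasure (W : WeightPair) {μ : Measure (ℝ × ℝ)}
    (h : W.IsBergerMeasure μ) : IsSubnormalPair W.T₁ W.T₂ := by
  obtain ⟨hprob, hsupp, hmom⟩ := h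
  have hae : ∀ᵐ p ∂μ, p ∈ Set.Icc 0 (‖W.T₁‖ ^ 2) ×ˢ Set.Icc 0 (‖W.T₂‖ ^ 2) := by rwa [ae_iff]
  let η : Measure UnitAddCircle := AddCircle.haarAddCircle
  -- The torus supplies the phases: distinct monomials carry distinct characters and so become
  -- orthogonal, while their moduli see only `μ`.
  let m : Measure ((ℝ × ℝ) × UnitAddCircle × UnitAddCircle) := μ.prod (η.prod η)
  have haem := Measure.quasiMeasurePreserving_fst (μ := μ) (ν := η.prod η) |>.ae hae
  have hnorm (x : UnitAddCircle) : ‖(fourier 1 x : ℂ)‖ = 1 := Circle.norm_coe _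
  have hz : MemLp (fun p : (ℝ × ℝ) × UnitAddCircle × UnitAddCircle =>
      (√p.1.1 : ℂ) * fourier 1 p.2.1) ∞ m := by
    refine memLp_top_of_bound (by fun_prop) ‖W.T₁‖ ?_
    filter_upwards [haem] with p hp
    rw [norm_mul, hnorm, mul_one, Complex.norm_real, Real.norm_of_nonneg (Real.sqrt_nonneg _)]
    exact Real.sqrt_le_iff.2 ⟨norm_nonneg _, hp.1.2⟩
  have hw : MemLp (fun p : (ℝ × ℝ) × UnitAddCircle × UnitAddCircle =>
      (√p.1.2 : ℂ) * fourier 1 p.2.2) ∞ m := by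
    refine memLp_top_of_bound (by fun_prop) ‖W.T₂‖ ?_
    filter_upwards [haem] with p hp
    rw [norm_mul, hnorm, mul_one, Complex.norm_real, Real.norm_of_nonneg (Real.sqrt_nonneg _)]
    exact Real.sqrt_le_iff.2 ⟨norm_nonneg _, hp.2.2⟩
  refine W.isSubnormalPair_of_orthogonal hz hw fun k l => ?_
  have hfour (a b : ℕ) (x : UnitAddCircle) : starRingEnd ℂ (fourier 1 x ^ a) * fourier 1 x ^ b =
      fourier ((b : ℤ) - a) x := by
    have hp (n : ℕ) : fourier 1 x ^ n = fourier (n : ℤ) x := by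
      simp [fourier_apply, AddCircle.toCircle_nsmul]
    rw [hp, hp, ← fourier_neg, ← fourier_add, neg_add_eq_sub]
  have hsplit : ∀ p : (ℝ × ℝ) × UnitAddCircle × UnitAddCircle,
      starRingEnd ℂ (((√p.1.1 : ℂ) * fourier 1 p.2.1) ^ k.1 *
        ((√p.1.2 : ℂ) * fourier 1 p.2.2) ^ k.2) *
        (((√p.1.1 : ℂ) * fourier 1 p.2.1) ^ l.1 * ((√p.1.2 : ℂ) * fourier 1 p.2.2) ^ l.2) =
      ((√p.1.1 : ℂ) ^ (k.1 + l.1) * (√p.1.2 : ℂ) ^ (k.2 + l.2)) *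
        (fourier ((l.1 : ℤ) - k.1) p.2.1 * fourier ((l.2 : ℤ) - k.2) p.2.2) := fun p => by
    rw [← hfour, ← hfour]
    simp only [map_mul, map_pow, Complex.conj_ofReal, mul_pow]
    ring
  simp only [hsplit]
  rw [integral_prod_mul (μ := μ) (ν := η.prod η)
      (fun p : ℝ × ℝ => (√p.1 : ℂ) ^ (k.1 + l.1) * (√p.2 : ℂ) ^ (k.2 + l.2))
      (fun p : UnitAddCircle × UnitAddCircle =>
        fourier ((l.1 : ℤ) - k.1) p.1 * fourier ((l.2 : ℤ) - k.2) p.2),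
    integral_prod_mul (μ := η) (ν := η) (fun x => fourier ((l.1 : ℤ) - k.1) x)
      (fun x => fourier ((l.2 : ℤ) - k.2) x),
    integral_fourier_haarAddCircle, integral_fourier_haarAddCircle]
  by_cases hkl : k = l
  · subst hkl
    simp only [sub_self, if_true, mul_one, ← hmom k]
    rw [← integral_complex_ofReal]
    refine integral_congr_ae ?_
    filter_upwards [hae] with p hp
    have h1 : √p.1 ^ (k.1 + k.1) = p.1 ^ k.1 := by
      rw [← two_mul, pow_mul, Real.sq_sqrt hp.1.1]
    have h2 : √p.2 ^ (k.2 + k.2) = p.2 ^ k.2 := by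
      rw [← two_mul, pow_mul, Real.sq_sqrt hp.2.1]
    rw [← h1, ← h2]
    push_cast
    rfl
  · rw [if_neg hkl]
    have : l.1 ≠ k.1 ∨ l.2 ≠ k.2 := by
      by_contra! hc
      exact hkl (Prod.ext hc.1.symm hc.2.symm)
    rcases this with h1 | h1
    · simp [sub_eq_zero, h1]
    · simp [sub_eq_zero, h1]

theorem isSubnormalPair_iff_exists_isBergerMeasure (W : WeightPair) :
    IsSubnormalPair W.T₁ W.T₂ ↔ ∃ μ, W.IsBergerMeasure μ :=
  ⟨W.exists_isBergerMeasure_of_isSubnormalPair,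
    fun ⟨_, h⟩ => W.isSubnormalPair_of_isBergerMeasure h⟩

end WeightPair

/-! ### The extremal measure and one-step extensions -/

theorem measurable_ofReal_snd : Measurable fun p : ℝ × ℝ => ENNReal.ofReal p.2 := by fun_prop

theorem measurable_inv_ofReal_snd : Measurable fun p : ℝ × ℝ => (ENNReal.ofReal p.2)⁻¹ :=
  measurable_ofReal_snd.inv

theorem invNorm_ne_zero (μ : Measure (ℝ × ℝ)) [NeZero μ] : invNorm μ ≠ 0 := by
  rw [invNorm, Ne, lintegral_eq_zero_iff measurable_inv_ofReal_snd]
  intro h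
  obtain ⟨p, hp⟩ := h.exists
  simp at hp

theorem ae_snd_pos_of_invNorm_lt_top {μ : Measure (ℝ × ℝ)} (h : invNorm μ < ∞) :
    ∀ᵐ p ∂μ, 0 < p.2 := by
  filter_upwards [ae_lt_top measurable_inv_ofReal_snd h.ne] with p hp
  simpa using hp

/-- The factor `‖1/t‖` cancels because it is neither 0 nor `∞`; the value of the density at `t = 0`
is irrelevant, as finiteness forces `t > 0` almost everywhere. -/
theorem smul_extremalMeasure {μ : Measure (ℝ × ℝ)} [NeZero μ] (h : invNorm μ < ∞) (b : ℝ≥0∞) :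
    (b * invNorm μ) • extremalMeasure μ =
      μ.withDensity fun p => b * (ENNReal.ofReal p.2)⁻¹ := by
  have hm : Measurable fun p : ℝ × ℝ =>
      if p.2 = 0 then 0 else (ENNReal.ofReal p.2 * invNorm μ)⁻¹ :=
    Measurable.ite (measurable_snd (measurableSet_singleton 0)) measurable_const
      (measurable_ofReal_snd.mul_const _).inv
  rw [extremalMeasure, ← withDensity_smul _ hm]
  refine withDensity_congr_ae ?_
  filter_upwards [ae_snd_pos_of_invNorm_lt_top h] with p hp
  rw [Pi.smul_apply, if_neg hp.ne', smul_eq_mul,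
    ENNReal.mul_inv (.inr h.ne) (.inr (invNorm_ne_zero μ)), mul_mul_mul_comm,
    ENNReal.mul_inv_cancel (invNorm_ne_zero μ) h.ne,
    mul_one]

theorem marginalX_add (μ ν : Measure (ℝ × ℝ)) :
    marginalX (μ + ν) = marginalX μ + marginalX ν := Measure.map_add _ _ measurable_fst

theorem marginalX_smul (c : ℝ≥0∞) (μ : Measure (ℝ × ℝ)) :
    marginalX (c • μ) = c • marginalX μ := Measure.map_smul _ _ _

instance (μ : Measure (ℝ × ℝ)) [IsFiniteMeasure μ] : IsFiniteMeasure (marginalX μ) := by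
  unfold marginalX; infer_instance

/-- A finite measure concentrated on `t ≥ 0` is the sum of its restriction to `t > 0` and of a
measure concentrated on `t = 0`, which is determined by the marginals. -/
theorem eq_restrict_add_prod_dirac {μ : Measure (ℝ × ℝ)} [IsFiniteMeasure μ]
    (h : ∀ᵐ p ∂μ, 0 ≤ p.2) :
    μ = μ.restrict {p | 0 < p.2} +
      (marginalX μ - marginalX (μ.restrict {p | 0 < p.2})).prod (Measure.dirac 0) := by
  have hS : MeasurableSet {p : ℝ × ℝ | 0 < p.2} := measurableSet_lt measurable_const measurable_snd
  have hadd := Measure.restrict_add_restrict_compl (μ := μ) hS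
  have hsub : marginalX μ - marginalX (μ.restrict {p | 0 < p.2}) =
      marginalX (μ.restrict {p | 0 < p.2}ᶜ) := by
    conv_lhs => enter [1]; rw [← hadd, marginalX_add, add_comm]
    exact Measure.add_sub_cancel
  have hprod : (marginalX (μ.restrict {p | 0 < p.2}ᶜ)).prod (Measure.dirac 0) =
      μ.restrict {p | 0 < p.2}ᶜ := by
    rw [Measure.prod_dirac, marginalX, Measure.map_map (by fun_prop) measurable_fst]
    conv_rhs => rw [← Measure.map_id (μ := μ.restrict {p | 0 < p.2}ᶜ)]
    refine Measure.map_congr ?_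
    filter_upwards [ae_restrict_of_ae h, ae_restrict_mem hS.compl] with p h1 h2
    exact Prod.ext rfl (le_antisymm h1 (not_lt.1 h2))
  rw [hsub, hprod, hadd]

namespace WeightPair

/-- Path independence again: the right-hand moment can be computed along a path whose first step is
up, with weight `β₀₀`. -/
theorem upper_moment_mul (W : WeightPair) (k : ℕ × ℕ) :
    W.upper.moment k * W.β (0, 0) ^ 2 = W.moment (k + (0, 1)) := by
  obtain ⟨k, l⟩ := k
  induction l with
  | zero =>
    induction k with
    | zero => simp [moment]
    | succ k ih =>
      have h1 := W.upper.moment_add_fst (k, 0)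
      have h2 := W.moment_add_fst (k, 1)
      simp only [Prod.mk_add_mk, add_zero, zero_add] at h1 h2 ih ⊢
      rw [h1, h2, ← ih]
      change _ * W.α ((k, 0) + (0, 1)) ^ 2 * _ = _
      simp only [Prod.mk_add_mk, add_zero, zero_add]
      ring
  | succ l ih =>
    have h1 := W.upper.moment_add_snd (k, l)
    have h2 := W.moment_add_snd (k, l + 1)
    simp only [Prod.mk_add_mk, add_zero] at h1 h2 ih ⊢
    rw [h1, h2, ← ih]
    change _ * W.β ((k, l) + (0, 1)) ^ 2 * _ = _
    simp only [Prod.mk_add_mk, add_zero]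
    ring

theorem IsBergerMeasure.ae_mem {W : WeightPair} {μ : Measure (ℝ × ℝ)} (h : W.IsBergerMeasure μ) :
    ∀ᵐ p ∂μ, p ∈ Set.Icc 0 (‖W.T₁‖ ^ 2) ×ˢ Set.Icc 0 (‖W.T₂‖ ^ 2) := by
  rw [ae_iff]
  exact h.2.1

/-- The bottom row of a pair with Berger measure `μ` has Berger measure `μ^X`. -/
theorem IsBergerMeasure.marginalX_eq {W : WeightPair} {μ : Measure (ℝ × ℝ)} {ν : Measure ℝ}
    (hμ : W.IsBergerMeasure μ) (hν : W.bottomRow.IsBergerMeasure ν) : marginalX μ = ν := by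
  have := hμ.1
  have := hν.1
  refine Measure.ext_of_moments_real
    (isCompact_Icc (a := 0) (b := max (‖W.T₁‖ ^ 2) (‖W.bottomRow.shift‖ ^ 2))) ?_ ?_ fun k => ?_
  · rw [marginalX, Measure.map_apply measurable_fst measurableSet_Icc.compl]
    change ∀ᵐ p ∂μ, p.1 ∈ Set.Icc 0 _
    filter_upwards [hμ.ae_mem] with p hp using ⟨hp.1.1, hp.1.2.trans (le_max_left _ _)⟩
  · refine measure_mono_null (Set.compl_subset_compl.2 ?_) hν.2.1
    exact Set.Icc_subset_Icc_right (le_max_right _ _)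
  · rw [hν.2.2, marginalX, integral_map measurable_fst.aemeasurable (by fun_prop)]
    simpa [moment, WeightSeq.moment, bottomRow] using hμ.2.2 (k, 0)

/-- Multiplying the Berger measure of a pair by `t` gives a multiple of the Berger measure of its
restriction to the upper rows. -/
theorem IsBergerMeasure.withDensity_snd {W : WeightPair} {μ μM : Measure (ℝ × ℝ)}
    (hμ : W.IsBergerMeasure μ) (hμM : W.upper.IsBergerMeasure μM) :
    μ.withDensity (fun p => ENNReal.ofReal p.2) = ENNReal.ofReal (W.β (0, 0) ^ 2) • μM := by
  have := hμ.1
  have := hμM.1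
  have hfin : IsFiniteMeasure (μ.withDensity fun p => ENNReal.ofReal p.2) := by
    refine isFiniteMeasure_withDensity_ofReal (Integrable.hasFiniteIntegral ?_)
    exact integrable_of_continuous_of_isCompact (isCompact_Icc.prod isCompact_Icc) hμ.2.1
      continuous_snd
  have hsmul : IsFiniteMeasure (ENNReal.ofReal (W.β (0, 0) ^ 2) • μM) :=
    Measure.smul_finite _ ENNReal.ofReal_ne_top
  refine Measure.ext_of_moments ((isCompact_Icc.prod isCompact_Icc).union
    (isCompact_Icc.prod isCompact_Icc)) (measure_mono_null (Set.compl_subset_compl.2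
      Set.subset_union_left) (withDensity_absolutelyContinuous _ _ hμ.2.1))
    (measure_mono_null (Set.compl_subset_compl.2 Set.subset_union_right)
      (Measure.smul_absolutelyContinuous hμM.2.1)) fun k l => ?_
  rw [integral_smul_measure, hμM.2.2 (k, l),
    integral_withDensity_eq_integral_toReal_smul measurable_ofReal_snd (by simp),
    ENNReal.toReal_ofReal (sq_nonneg _), smul_eq_mul, mul_comm, W.upper_moment_mul]
  rw [← hμ.2.2]
  refine integral_congr_ae ?_
  filter_upwards [hμ.ae_mem] with p hp
  simp only [Prod.mk_add_mk, add_zero, smul_eq_mul, ENNReal.toReal_ofReal hp.2.1]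
  ring

theorem IsBergerMeasure.eq_smul_withDensity_snd {W : WeightPair} {μ μM : Measure (ℝ × ℝ)}
    (hμ : W.IsBergerMeasure μ) (hμM : W.upper.IsBergerMeasure μM) :
    μM = (ENNReal.ofReal (W.β (0, 0) ^ 2))⁻¹ • μ.withDensity (fun p => ENNReal.ofReal p.2) := by
  have hb : ENNReal.ofReal (W.β (0, 0) ^ 2) ≠ 0 := by simpa using (W.β_pos (0, 0)).ne'
  rw [hμ.withDensity_snd hμM, smul_smul, ENNReal.inv_mul_cancel hb ENNReal.ofReal_ne_top,
    one_smul]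

/-- Integrate `1/t` against `t dμ = β₀₀² dμM`: the product `t · (1/t)` is the indicator of `t > 0`,
since `0 · ∞ = 0`. -/
theorem IsBergerMeasure.mul_invNorm {W : WeightPair} {μ μM : Measure (ℝ × ℝ)}
    (hμ : W.IsBergerMeasure μ) (hμM : W.upper.IsBergerMeasure μM) :
    ENNReal.ofReal (W.β (0, 0) ^ 2) * invNorm μM = μ {p | 0 < p.2} := by
  have hb : ENNReal.ofReal (W.β (0, 0) ^ 2) ≠ 0 := by simpa using (W.β_pos (0, 0)).ne'
  have hS : MeasurableSet {p : ℝ × ℝ | 0 < p.2} := measurableSet_lt measurable_const measurable_snd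
  rw [hμ.eq_smul_withDensity_snd hμM, invNorm, lintegral_smul_measure, smul_eq_mul, ← mul_assoc,
    ENNReal.mul_inv_cancel hb ENNReal.ofReal_ne_top, one_mul,
    lintegral_withDensity_eq_lintegral_mul _ measurable_ofReal_snd measurable_inv_ofReal_snd,
    ← lintegral_indicator_one hS]
  refine lintegral_congr fun p => ?_
  by_cases hp : 0 < p.2
  · simp [hp, ENNReal.mul_inv_cancel]
  · simp [hp, ENNReal.ofReal_eq_zero.2 (not_lt.1 hp)]

theorem IsBergerMeasure.invNorm_lt_top {W : WeightPair} {μ μM : Measure (ℝ × ℝ)}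
    (hμ : W.IsBergerMeasure μ) (hμM : W.upper.IsBergerMeasure μM) : invNorm μM < ∞ := by
  have := hμ.1
  have hb : ENNReal.ofReal (W.β (0, 0) ^ 2) ≠ 0 := by simpa using (W.β_pos (0, 0)).ne'
  have h : ENNReal.ofReal (W.β (0, 0) ^ 2) * invNorm μM ≠ ∞ := by
    rw [hμ.mul_invNorm hμM]
    exact measure_ne_top _ _
  exact lt_top_iff_ne_top.2 fun htop => h (by rw [htop, ENNReal.mul_top hb])

theorem IsBergerMeasure.smul_extremalMeasure {W : WeightPair} {μ μM : Measure (ℝ × ℝ)}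
    (hμ : W.IsBergerMeasure μ) (hμM : W.upper.IsBergerMeasure μM) :
    (ENNReal.ofReal (W.β (0, 0) ^ 2) * invNorm μM) • extremalMeasure μM =
      μ.restrict {p | 0 < p.2} := by
  have := hμM.1
  have hb : ENNReal.ofReal (W.β (0, 0) ^ 2) ≠ 0 := by simpa using (W.β_pos (0, 0)).ne'
  have hS : MeasurableSet {p : ℝ × ℝ | 0 < p.2} := measurableSet_lt measurable_const measurable_snd
  rw [_root_.smul_extremalMeasure (hμ.invNorm_lt_top hμM)]
  have hfun : (fun p : ℝ × ℝ => ENNReal.ofReal (W.β (0, 0) ^ 2) * (ENNReal.ofReal p.2)⁻¹) =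
      ENNReal.ofReal (W.β (0, 0) ^ 2) • fun p : ℝ × ℝ => (ENNReal.ofReal p.2)⁻¹ := rfl
  rw [hfun, withDensity_smul _ measurable_inv_ofReal_snd, ← withDensity_smul_measure,
    ← hμ.withDensity_snd hμM, ← withDensity_mul _ measurable_ofReal_snd measurable_inv_ofReal_snd,
    ← withDensity_indicator_one hS]
  congr 1
  funext p
  by_cases hp : 0 < p.2
  · simp [hp, ENNReal.mul_inv_cancel]
  · simp [hp, ENNReal.ofReal_eq_zero.2 (not_lt.1 hp)]

/-- The measure built from the extremal measure of the upper rows and the Berger measure of the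
bottom row is a Berger measure of the pair. -/
theorem isBergerMeasure_extremal {W : WeightPair} {μM : Measure (ℝ × ℝ)} {ν : Measure ℝ}
    (hμM : W.upper.IsBergerMeasure μM) (hν : W.bottomRow.IsBergerMeasure ν)
    (hfin : invNorm μM < ∞)
    (hle : (ENNReal.ofReal (W.β (0, 0) ^ 2) * invNorm μM) • marginalX (extremalMeasure μM) ≤ ν) :
    W.IsBergerMeasure ((ENNReal.ofReal (W.β (0, 0) ^ 2) * invNorm μM) • extremalMeasure μM +
      (ν - (ENNReal.ofReal (W.β (0, 0) ^ 2) * invNorm μM) •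
        marginalX (extremalMeasure μM)).prod (Measure.dirac 0)) := by
  have := hμM.1
  have := hν.1
  rw [← marginalX_smul, smul_extremalMeasure hfin] at hle ⊢
  set σ := μM.withDensity fun p => ENNReal.ofReal (W.β (0, 0) ^ 2) * (ENNReal.ofReal p.2)⁻¹
    with hσ
  have hm : Measurable fun p : ℝ × ℝ =>
      ENNReal.ofReal (W.β (0, 0) ^ 2) * (ENNReal.ofReal p.2)⁻¹ :=
    measurable_inv_ofReal_snd.const_mul _
  have hσfin : IsFiniteMeasure σ := by
    refine isFiniteMeasure_withDensity ?_
    rw [lintegral_const_mul _ measurable_inv_ofReal_snd]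
    exact ENNReal.mul_ne_top ENNReal.ofReal_ne_top hfin.ne
  have hpos := ae_snd_pos_of_invNorm_lt_top hfin
  have hτle : ν - marginalX σ ≤ ν := Measure.sub_le
  have hτfin : IsFiniteMeasure (ν - marginalX σ) := isFiniteMeasure_of_le ν hτle
  rw [Measure.prod_dirac]
  set τ := (ν - marginalX σ).map fun s => (s, (0 : ℝ)) with hτ
  have hm0 : Measurable fun s : ℝ => (s, (0 : ℝ)) := by fun_prop
  -- A crude rectangle containing both supports; `isBergerMeasure_of_moment` sharpens it.
  let A := max (‖W.upper.T₁‖ ^ 2) (‖W.bottomRow.shift‖ ^ 2)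
  have hK : IsCompact (Set.Icc 0 A ×ˢ Set.Icc 0 (‖W.upper.T₂‖ ^ 2)) :=
    isCompact_Icc.prod isCompact_Icc
  have hσK : σ (Set.Icc 0 A ×ˢ Set.Icc 0 (‖W.upper.T₂‖ ^ 2))ᶜ = 0 :=
    measure_mono_null (Set.compl_subset_compl.2 (Set.prod_mono_left
      (Set.Icc_subset_Icc_right (le_max_left _ _))))
      (withDensity_absolutelyContinuous _ _ hμM.2.1)
  have hτK : τ (Set.Icc 0 A ×ˢ Set.Icc 0 (‖W.upper.T₂‖ ^ 2))ᶜ = 0 := by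
    rw [hτ, Measure.map_apply hm0 hK.measurableSet.compl]
    refine measure_mono_null ?_ (Measure.absolutelyContinuous_of_le hτle hν.2.1)
    intro s hs hs'
    exact hs ⟨⟨hs'.1, hs'.2.trans (le_max_right _ _)⟩, ⟨le_rfl, by positivity⟩⟩
  refine W.isBergerMeasure_of_moment (A := A) (B := ‖W.upper.T₂‖ ^ 2) ?_ fun ⟨k, l⟩ => ?_
  · rw [Measure.add_apply, hσK, hτK, add_zero]
  · have hi (ρ : Measure (ℝ × ℝ)) [IsFiniteMeasure ρ]
        (hρ : ρ (Set.Icc 0 A ×ˢ Set.Icc 0 (‖W.upper.T₂‖ ^ 2))ᶜ = 0) :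
        Integrable (fun p => p.1 ^ k * p.2 ^ l) ρ :=
      integrable_of_continuous_of_isCompact hK hρ (by fun_prop)
    -- For `l = 0` only the marginal `ν` matters. For `l ≥ 1` the part on `t = 0` contributes
    -- nothing, and one factor `t` cancels the density `β₀₀² / t`.
    cases l with
    | zero =>
      have hmarg : marginalX (σ + τ) = ν := by
        have : marginalX τ = ν - marginalX σ := by
          rw [hτ, marginalX, Measure.map_map measurable_fst hm0]
          exact Measure.map_id
        rw [marginalX_add, this, add_comm, Measure.sub_add_cancel_of_le hle]
      have := hν.2.2 k
      rw [← hmarg, marginalX, integral_map measurable_fst.aemeasurable (by fun_prop)] at this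
      simpa [moment, WeightSeq.moment, bottomRow] using this
    | succ l =>
      rw [integral_add_measure (hi σ hσK) (hi τ hτK), hτ,
        integral_map hm0.aemeasurable (by fun_prop)]
      have := W.upper_moment_mul (k, l)
      simp only [Prod.mk_add_mk, add_zero] at this
      rw [← this, ← hμM.2.2 (k, l), hσ, integral_withDensity_eq_integral_toReal_smul hm,
        ← integral_mul_const]
      · simp only [ne_eq, Nat.add_eq_zero_iff, one_ne_zero, and_false, not_false_eq_true,
          zero_pow, mul_zero, integral_zero, add_zero]
        refine integral_congr_ae ?_
        filter_upwards [hpos] with p hp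
        rw [ENNReal.toReal_mul, ENNReal.toReal_inv, ENNReal.toReal_ofReal hp.le,
          ENNReal.toReal_ofReal (sq_nonneg _), smul_eq_mul, pow_succ]
        field_simp
        ring
      · filter_upwards [hpos] with p hp
        exact ENNReal.mul_lt_top ENNReal.ofReal_lt_top (by simpa using hp)

end WeightPair

theorem mainTheorem5 (W : WeightPair) (μM : Measure (ℝ × ℝ)) (ν : Measure ℝ)
    (hM : IsSubnormalPair W.T₁M W.T₂M) (hμM : W.upper.IsBergerMeasure μM)
    (hW₀ : IsSubnormalOp W.bottomRow.shift) (hν : W.bottomRow.IsBergerMeasure ν) :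
    (IsSubnormalPair W.T₁ W.T₂ ↔
      invNorm μM < ∞ ∧
      ENNReal.ofReal (W.β (0, 0) ^ 2) ≤ (invNorm μM)⁻¹ ∧
      (ENNReal.ofReal (W.β (0, 0) ^ 2) * invNorm μM) • marginalX (extremalMeasure μM) ≤ ν) ∧
    (IsSubnormalPair W.T₁ W.T₂ →
      ENNReal.ofReal (W.β (0, 0) ^ 2) * invNorm μM = 1 →
        marginalX (extremalMeasure μM) = ν) ∧
    (IsSubnormalPair W.T₁ W.T₂ →
      ∀ μ : Measure (ℝ × ℝ), W.IsBergerMeasure μ ↔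
        μ = (ENNReal.ofReal (W.β (0, 0) ^ 2) * invNorm μM) • extremalMeasure μM +
          (ν - (ENNReal.ofReal (W.β (0, 0) ^ 2) * invNorm μM) •
            marginalX (extremalMeasure μM)).prod (Measure.dirac 0)) := by
  have := hμM.1
  have formula {μ : Measure (ℝ × ℝ)} (hμ : W.IsBergerMeasure μ) :
      μ = (ENNReal.ofReal (W.β (0, 0) ^ 2) * invNorm μM) • extremalMeasure μM +
        (ν - (ENNReal.ofReal (W.β (0, 0) ^ 2) * invNorm μM) •
          marginalX (extremalMeasure μM)).prod (Measure.dirac 0) := by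
    have := hμ.1
    rw [← marginalX_smul, hμ.smul_extremalMeasure hμM, ← hμ.marginalX_eq hν]
    exact eq_restrict_add_prod_dirac (hμ.ae_mem.mono fun p hp => hp.2.1)
  rw [W.isSubnormalPair_iff_exists_isBergerMeasure]
  refine ⟨⟨?_, ?_⟩, ?_, ?_⟩
  · rintro ⟨μ, hμ⟩
    have := hμ.1
    refine ⟨hμ.invNorm_lt_top hμM, ?_, ?_⟩
    · rw [ENNReal.le_inv_iff_mul_le, hμ.mul_invNorm hμM]
      exact prob_le_one
    · rw [← marginalX_smul, hμ.smul_extremalMeasure hμM, ← hμ.marginalX_eq hν]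
      exact Measure.map_mono Measure.restrict_le_self measurable_fst
  -- The second condition follows from the third by comparing total masses.
  · rintro ⟨hfin, -, hle⟩
    exact ⟨_, WeightPair.isBergerMeasure_extremal hμM hν hfin hle⟩
  · rintro ⟨μ, hμ⟩ h1
    have := hμ.1
    have hS : MeasurableSet {p : ℝ × ℝ | 0 < p.2} :=
      measurableSet_lt measurable_const measurable_snd
    have hext := hμ.smul_extremalMeasure hμM
    -- The set `t > 0` has full measure here, so `μ` is the extremal measure itself.
    rw [h1, one_smul, Measure.restrict_eq_self_of_ae_mem] at hext
    · rw [hext, hμ.marginalX_eq hν]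
    · rw [hμ.mul_invNorm hμM] at h1
      exact (prob_compl_eq_zero_iff hS).2 h1
  · rintro ⟨μ₀, hμ₀⟩ μ
    refine ⟨formula, fun h => ?_⟩
    -- The formula involves only `μM`, `ν` and `β₀₀`, so it also describes the known Berger measure
    -- `μ₀`.
    rwa [h, ← formula hμ₀]
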